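/- Conventions. Rings are associative and unital; tensor products are over $\mathbb{Z}$. For a simplicial ring $R$, let $C(R)$ be the total complex of the double complex with $R_p^{\otimes (q+1)}$ in bidegree $(p,q)$, with the alternating sum of the simplicial face maps in the $p$-direction and the Hochschild boundary $b$ in the $q$-direction (with the usual sign). Together with Connes' operator $B$ (of degree $+1$, with $B^2=0$ and $dB+Bd=0$), it is a mixed complex. Hochschild homology $HH_*(R)$ is the homology of $C(R)$. Negative cyclic homology $HC^-_*(R)$ is the homology of the complex whose $n$-chains are the series $\sum_{i\ge 0} x_i t^i$ with $x_i \in C(R)_{n+2i}$, with differential $d+tB$. The projection $\sum_i x_i t^i \mapsto x_0$ induces the natural map $F\colon HC^-_*(R)\to HH_*(R)$. For a map $f\colon R\to R'$ of simplicial rings, $HH_*(f)$ and $HC^-_*(f)$ denote the homology groups ($*\in\mathbb{Z}$) of the homotopy fibers of the maps of complexes computing $HH_*(R)\to HH_*(R')$ and $HC^-_*(R)\to HC^-_*(R')$, respectively. There is an induced map $F\colon HC^-_*(f)\to HH_*(f)$. The homotopy fiber of $C(R)\to C(R')$ inherits the structure of a mixed complex, which gives the relative operator $B\colon HH_*(f)\to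 HH_{*+1}(f)$ with $BB=0$. The map $f$ is called a de Rham equivalence if the homology $H^{dR}_*(f)=\ker(B)/\operatorname{im}(B)$ of $HH_*(f)$ with respect to $B$ vanishes in every degree. Proposition 1.8. If $f\colon R\to R'$ is a de Rham equivalence of simplicial rings, then for every integer $n$ the sequence $$0\to HC^-_n(f)\xrightarrow{\;F\;} HH_n(f)\xrightarrow{\;B\;} HH_{n+1}(f)$$ is exact. Hence $F$ identifies $HC^-_n(f)$ with $\ker(B)\subset HH_n(f)$. -/

import Mathlib

open CategoryTheory

universe u v

namespace Cyclic

/-! ### Chain complexes, mixed complexes, homotopy fibers, negative cyclic homology -/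

/-- A `ℤ`-graded chain complex of abelian groups.  It is presented inside one ambient abelian
group `T`: the group of `n`-chains is the subgroup `gr n`, and the differential, of degree `-1`,
is the restriction of an endomorphism `d` of `T`. -/
structure Cx where
  T : Type u
  [grp : AddCommGroup T]
  gr : ℤ → AddSubgroup T
  d : T →+ T
  d_mem : ∀ n x, x ∈ gr n → d x ∈ gr (n - 1)
  d_d : ∀ x, d (d x) = 0

attribute [instance] Cx.grp

namespace Cx

/-- The `n`-cycles `{x ∈ Cₙ | d x = 0}`. -/
def cycles (C : Cx.{u}) (n : ℤ) : AddSubgroup C.T := C.gr n ⊓ C.d.ker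

/-- The `n`-boundaries `d(Cₙ₊₁)`. -/
def boundaries (C : Cx.{u}) (n : ℤ) : AddSubgroup C.T := (C.gr (n + 1)).map C.d

/-- The homology group `Hₙ(C)`, cycles modulo boundaries. -/
abbrev H (C : Cx.{u}) (n : ℤ) : Type u :=
  C.cycles n ⧸ (C.boundaries n).addSubgroupOf (C.cycles n)

/-- The map `Hₙ(C) → Hₘ(C')` induced by an additive map that sends cycles to cycles and
boundaries to boundaries. -/
def inducedMap {C : Cx.{u}} {C' : Cx.{v}} {n m : ℤ} (φ : C.T →+ C'.T)
    (hz : ∀ x ∈ C.cycles n, φ x ∈ C'.cycles m)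
    (hb : ∀ x ∈ C.boundaries n, φ x ∈ C'.boundaries m) : C.H n →+ C'.H m :=
  QuotientAddGroup.map _ _
    ((φ.comp (C.cycles n).subtype).codRestrict (C'.cycles m) fun x => hz x x.2)
    (fun x hx => hb x hx)

/-- A chain map. -/
structure Hom (C : Cx.{u}) (C' : Cx.{v}) where
  φ : C.T →+ C'.T
  φ_mem : ∀ n x, x ∈ C.gr n → φ x ∈ C'.gr n
  φ_d : ∀ x, φ (C.d x) = C'.d (φ x)

/-- The map induced on homology by a chain map. -/
def Hom.homology {C : Cx.{u}} {C' : Cx.{v}} (f : Hom C C') (n : ℤ) : C.H n →+ C'.H n :=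
  inducedMap f.φ
    (by
      rintro x ⟨h1, h2⟩
      refine ⟨f.φ_mem n x h1, ?_⟩
      have h2' : C.d x = 0 := h2
      change C'.d (f.φ x) = 0
      rw [← f.φ_d, h2', map_zero])
    (by
      rintro _ ⟨y, hy, rfl⟩
      exact ⟨f.φ y, f.φ_mem _ y hy, (f.φ_d y).symm⟩)

/-- The homotopy fiber of a chain map `f : C → C'`: in degree `n` it is `Cₙ × C'ₙ₊₁`, with
differential `(x, y) ↦ (d x, f x - d y)`. -/
def fiber {C : Cx.{u}} {C' : Cx.{v}} (f : Hom C C') : Cx.{max u v} where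
  T := C.T × C'.T
  gr n := (C.gr n).prod (C'.gr (n + 1))
  d := (C.d.comp (AddMonoidHom.fst _ _)).prod
    (f.φ.comp (AddMonoidHom.fst _ _) - C'.d.comp (AddMonoidHom.snd _ _))
  d_mem := by
    rintro n ⟨x, y⟩ ⟨hx, hy⟩
    refine ⟨C.d_mem n x hx, ?_⟩
    have h := C'.d_mem _ y hy
    have e : n + 1 - 1 = n - 1 + 1 := by ring
    have e' : n - 1 + 1 = n := by ring
    rw [e] at h
    have h' := f.φ_mem n x hx
    rw [← e'] at h'
    exact (C'.gr (n - 1 + 1)).sub_mem h' h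
  d_d := by
    rintro ⟨x, y⟩
    ext
    · simp [C.d_d]
    · simp [C'.d_d, f.φ_d]

end Cx

/-- A mixed complex: a chain complex with an operator `B` of degree `+1` such that `B² = 0` and
`dB + Bd = 0`. -/
structure Mixed extends Cx.{u} where
  B : T →+ T
  B_mem : ∀ n x, x ∈ gr n → B x ∈ gr (n + 1)
  B_B : ∀ x, B (B x) = 0
  d_B : ∀ x, d (B x) + B (d x) = 0

namespace Mixed

/-- The operator `B : Hᵢ(M) → Hⱼ(M)`, for `j = i + 1`, induced on homology. -/
def homologyB (M : Mixed.{u}) (i j : ℤ) (hij : i + 1 = j) : M.toCx.H i →+ M.toCx.H j :=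
  Cx.inducedMap M.B
    (by
      subst hij
      rintro x ⟨h1, h2⟩
      refine ⟨M.B_mem i x h1, ?_⟩
      have h2' : M.d x = 0 := h2
      have h := M.d_B x
      rw [h2', map_zero, add_zero] at h
      exact h)
    (by
      subst hij
      rintro _ ⟨y, hy, rfl⟩
      refine ⟨- M.B y, neg_mem (M.B_mem _ y hy), ?_⟩
      rw [map_neg, neg_eq_iff_add_eq_zero]
      exact M.d_B y)

/-- De Rham homology: the homology `ker B / im B` of `H_*(M)` with respect to the operator `B`,
in degree `n`. -/
abbrev deRham (M : Mixed.{u}) (n : ℤ) : Type u :=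
  (M.homologyB n (n + 1) rfl).ker ⧸
    ((M.homologyB (n - 1) n (by ring)).range.addSubgroupOf (M.homologyB n (n + 1) rfl).ker)

/-- A map of mixed complexes. -/
structure Hom (M : Mixed.{u}) (M' : Mixed.{v}) extends Cx.Hom M.toCx M'.toCx where
  φ_B : ∀ x, φ (M.B x) = M'.B (φ x)

/-- The homotopy fiber of a map of mixed complexes, with `B (x, y) = (B x, - B y)`. -/
def fiber {M : Mixed.{u}} {M' : Mixed.{v}} (f : Hom M M') : Mixed.{max u v} where
  toCx := Cx.fiber f.toHom
  B := (M.B.comp (AddMonoidHom.fst _ _)).prod (-(M'.B.comp (AddMonoidHom.snd _ _)))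
  B_mem := by
    rintro n ⟨x, y⟩ ⟨hx, hy⟩
    exact ⟨M.B_mem n x hx, (M'.gr (n + 1 + 1)).neg_mem (M'.B_mem _ y hy)⟩
  B_B := by
    rintro ⟨x, y⟩
    apply Prod.ext
    · change M.B (M.B x) = 0
      exact M.B_B x
    · change -M'.B (-M'.B y) = 0
      rw [map_neg, M'.B_B, neg_zero, neg_zero]
  d_B := by
    rintro ⟨x, y⟩
    have h2 := M'.d_B y
    apply Prod.ext
    · change M.d (M.B x) + M.B (M.d x) = 0
      exact M.d_B x
    · change (f.φ (M.B x) - M'.d (-M'.B y)) + -M'.B (f.φ x - M'.d y) = 0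
      rw [map_neg, map_sub, f.φ_B, ← h2]
      abel

/-- The part `∑ xᵢ tⁱ ↦ ∑ B(xᵢ) tⁱ⁺¹` of the differential of the negative cyclic complex. -/
def tB (M : Mixed.{u}) : (ℕ → M.T) →+ (ℕ → M.T) where
  toFun x i := match i with
    | 0 => 0
    | i + 1 => M.B (x i)
  map_zero' := by
    funext i
    cases i <;> simp
  map_add' x y := by
    funext i
    cases i <;> simp

/-- The negative cyclic complex of a mixed complex.  Its `n`-chains are the power series
`∑ᵢ xᵢ tⁱ` with `xᵢ ∈ Mₙ₊₂ᵢ` (so `t` has degree `-2`), and its differential is `d + tB`. -/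
def negCyclic (M : Mixed.{u}) : Cx.{u} where
  T := ℕ → M.T
  gr n := AddSubgroup.pi Set.univ fun i => M.gr (n + 2 * i)
  d := M.d.compLeft ℕ + M.tB
  d_mem := by
    intro n x hx i _
    have hd : M.d (x i) ∈ M.gr (n - 1 + 2 * i) := by
      have := M.d_mem _ _ (hx i trivial)
      rwa [show n + 2 * (i : ℤ) - 1 = n - 1 + 2 * i by ring] at this
    refine add_mem hd ?_
    cases i with
    | zero => exact zero_mem _
    | succ i =>
      have := M.B_mem _ _ (hx i trivial)
      rwa [show n + 2 * (i : ℤ) + 1 = n - 1 + 2 * ((i + 1 : ℕ) : ℤ) by push_cast; ring] at this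
  d_d := by
    intro x
    funext i
    rcases i with _ | _ | i
    · change M.d (M.d (x 0) + 0) + 0 = 0
      simp [M.d_d]
    · change M.d (M.d (x 1) + M.B (x 0)) + M.B (M.d (x 0) + 0) = 0
      simp [M.d_d, M.d_B]
    · change M.d (M.d (x (i + 2)) + M.B (x (i + 1))) + M.B (M.d (x (i + 1)) + M.B (x i)) = 0
      simp [M.d_d, M.d_B, M.B_B]

/-- The chain map induced on negative cyclic complexes by a map of mixed complexes. -/
def negCyclicMap {M : Mixed.{u}} {M' : Mixed.{v}} (f : Hom M M') :
    Cx.Hom M.negCyclic M'.negCyclic where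
  φ := f.φ.compLeft ℕ
  φ_mem := fun _ x hx i hi => f.φ_mem _ (x i) (hx i hi)
  φ_d := by
    intro x
    funext i
    cases i with
    | zero =>
      change f.φ (M.d (x 0) + 0) = M'.d (f.φ (x 0)) + 0
      simp [f.φ_d]
    | succ i =>
      change f.φ (M.d (x (i + 1)) + M.B (x i)) = M'.d (f.φ (x (i + 1))) + M'.B (f.φ (x i))
      simp [f.φ_d, f.φ_B]

/-- The chain map from the homotopy fiber of the map of negative cyclic complexes to the homotopy
fiber of the map of underlying complexes, induced by the projection `∑ xᵢ tⁱ ↦ x₀`. -/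
def fiberF {M : Mixed.{u}} {M' : Mixed.{v}} (f : Hom M M') :
    Cx.Hom (Cx.fiber (negCyclicMap f)) (fiber f).toCx where
  φ := ((Pi.evalAddMonoidHom (fun _ : ℕ => M.T) 0).comp (AddMonoidHom.fst _ _)).prod
    ((Pi.evalAddMonoidHom (fun _ : ℕ => M'.T) 0).comp (AddMonoidHom.snd _ _))
  φ_mem := by
    rintro n ⟨x, y⟩ ⟨hx, hy⟩
    have h1 : x 0 ∈ M.gr (n + 2 * ((0 : ℕ) : ℤ)) := hx 0 trivial
    have h2 : y 0 ∈ M'.gr (n + 1 + 2 * ((0 : ℕ) : ℤ)) := hy 0 trivial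
    refine ⟨?_, ?_⟩
    · rwa [Nat.cast_zero, mul_zero, add_zero] at h1
    · rwa [Nat.cast_zero, mul_zero, add_zero] at h2
  φ_d := by
    rintro ⟨x, y⟩
    apply Prod.ext
    · change M.d (x 0) + 0 = M.d (x 0)
      simp
    · change f.φ (x 0) - (M'.d (y 0) + 0) = f.φ (x 0) - M'.d (y 0)
      simp

end Mixed

/-! ### The cyclic bar construction of a ring -/

open scoped TensorProduct

/-- `A^{⊗(n+1)}`, tensor product over `ℤ`. -/
abbrev Tens (A : Type u) [Ring A] (n : ℕ) : Type u := ⨂[ℤ] (_ : Fin (n + 1)), A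

section tuples

variable {A : Type u}

/-- The operation `dᵢ` (for `0 ≤ i ≤ n + 1`) on tuples: it sends `(a₀, …, aₙ₊₁)` to
`(a₀, …, aᵢ aᵢ₊₁, …, aₙ₊₁)` if `i ≤ n`, and to `(aₙ₊₁ a₀, a₁, …, aₙ)` if `i = n + 1`. -/
def faceTuple [Mul A] (n i : ℕ) (v : Fin (n + 2) → A) : Fin (n + 1) → A := fun j =>
  if n < i ∧ j = 0 then v (Fin.last _) * v 0
  else if (j : ℕ) < i then v j.castSucc
  else if (j : ℕ) = i then v j.castSucc * v j.succ
  else v j.succ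

/-- The cyclic permutation `(a₀, …, aₙ) ↦ (aₙ, a₀, …, aₙ₋₁)`. -/
def rotTuple (n : ℕ) (v : Fin (n + 1) → A) : Fin (n + 1) → A :=
  Fin.cons (v (Fin.last n)) (fun j : Fin n => v j.castSucc)

/-- The extra degeneracy `(a₀, …, aₙ) ↦ (1, a₀, …, aₙ)`. -/
def extraTuple [One A] (n : ℕ) (v : Fin (n + 1) → A) : Fin (n + 2) → A := Fin.cons 1 v

end tuples

theorem rotTuple_apply {A : Type u} (n : ℕ) (v : Fin (n + 1) → A) (j : Fin (n + 1)) :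
    rotTuple n v j = v (j - 1) := by
  refine Fin.cases ?_ (fun j => ?_) j
  · simp only [rotTuple, Fin.cons_zero]
    congr 1
    rw [eq_sub_iff_add_eq, Fin.last_add_one]
  · simp only [rotTuple, Fin.cons_succ]
    congr 1
    rw [eq_sub_iff_add_eq]
    simp

section tupleLemmas

variable {A : Type u} [Ring A]

/-- Changing one entry of the input of `φ` changes one entry of the output, additively. -/
def EntrywiseLinear {A A' : Type u} [Ring A] [Ring A'] {m k : ℕ}
    (φ : (Fin m → A) → (Fin k → A')) : Prop :=
  ∀ (v : Fin m → A) (i : Fin m), ∃ (j : Fin k) (L : A →ₗ[ℤ] A'), ∀ x,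
    φ (Function.update v i x) = Function.update (φ v) j (L x)

theorem faceTuple_linear (n i : ℕ) : EntrywiseLinear (faceTuple (A := A) n i) := by
  intro v k
  have hk := k.isLt
  by_cases hi : n < i
  · by_cases h0 : (k : ℕ) = 0
    · refine ⟨0, LinearMap.mulLeft ℤ (v (Fin.last _)), fun x => ?_⟩
      funext j
      simp only [faceTuple, Function.update_apply, Fin.ext_iff, LinearMap.mulLeft_apply]
      simp only [Fin.val_zero, Fin.val_last, Fin.val_castSucc, Fin.val_succ]
      grind
    by_cases h1 : (k : ℕ) = n + 1
    · refine ⟨0, LinearMap.mulRight ℤ (v 0), fun x => ?_⟩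
      funext j
      have hj := j.isLt
      simp only [faceTuple, Function.update_apply, Fin.ext_iff, LinearMap.mulRight_apply]
      simp only [Fin.val_zero, Fin.val_last, Fin.val_castSucc, Fin.val_succ]
      grind
    · refine ⟨⟨k, by omega⟩, LinearMap.id, fun x => ?_⟩
      funext j
      have hj := j.isLt
      simp only [faceTuple, Function.update_apply, Fin.ext_iff, LinearMap.id_apply]
      simp only [Fin.val_zero, Fin.val_last, Fin.val_castSucc, Fin.val_succ]
      grind
  · rcases lt_trichotomy (k : ℕ) i with h | h | h
    · refine ⟨⟨k, by omega⟩, LinearMap.id, fun x => ?_⟩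
      funext j
      have hj := j.isLt
      simp only [faceTuple, Function.update_apply, Fin.ext_iff, LinearMap.id_apply]
      simp only [Fin.val_zero, Fin.val_last, Fin.val_castSucc, Fin.val_succ]
      grind
    · refine ⟨⟨i, by omega⟩, LinearMap.mulRight ℤ (v ⟨i + 1, by omega⟩), fun x => ?_⟩
      funext j
      have hj := j.isLt
      simp only [faceTuple, Function.update_apply, Fin.ext_iff, LinearMap.mulRight_apply]
      simp only [Fin.val_zero, Fin.val_last, Fin.val_castSucc, Fin.val_succ]
      grind
    · by_cases h1 : (k : ℕ) = i + 1
      · refine ⟨⟨i, by omega⟩, LinearMap.mulLeft ℤ (v ⟨i, by omega⟩), fun x => ?_⟩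
        funext j
        have hj := j.isLt
        have hc : (j : ℕ) = i → j.castSucc = ⟨i, by omega⟩ := fun h => Fin.ext h
        simp only [faceTuple, Function.update_apply, Fin.ext_iff, LinearMap.mulLeft_apply]
        simp only [Fin.val_zero, Fin.val_last, Fin.val_castSucc, Fin.val_succ]
        grind
      · refine ⟨⟨k - 1, by omega⟩, LinearMap.id, fun x => ?_⟩
        funext j
        have hj := j.isLt
        simp only [faceTuple, Function.update_apply, Fin.ext_iff, LinearMap.id_apply]
        simp only [Fin.val_zero, Fin.val_last, Fin.val_castSucc, Fin.val_succ]
        grind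

theorem rotTuple_linear (n : ℕ) : EntrywiseLinear (rotTuple (A := A) n) := by
  intro v k
  refine ⟨k + 1, LinearMap.id, fun x => ?_⟩
  funext j
  simp only [rotTuple_apply, Function.update_apply, LinearMap.id_apply, sub_eq_iff_eq_add]

theorem extraTuple_linear (n : ℕ) : EntrywiseLinear (extraTuple (A := A) n) := by
  intro v k
  refine ⟨k.succ, LinearMap.id, fun x => ?_⟩
  simp only [extraTuple, LinearMap.id_apply, Fin.cons_update]

theorem comp_linear {A' : Type u} [Ring A'] (f : A →+* A') (n : ℕ) :
    EntrywiseLinear (fun v : Fin n → A => fun j => f (v j)) := by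
  intro v k
  refine ⟨k, f.toAddMonoidHom.toIntLinearMap, fun x => ?_⟩
  funext j
  by_cases h : j = k
  · subst h
    simp
  · simp [Function.update_of_ne h]

end tupleLemmas

/-- The additive map of tensor powers `a₀ ⊗ ⋯ ⊗ aₙ ↦ ⨂ φ (a₀, …, aₙ)`. -/
noncomputable def ofTuple {A A' : Type u} [Ring A] [Ring A'] {n m : ℕ}
    (φ : (Fin (n + 1) → A) → (Fin (m + 1) → A')) (hφ : EntrywiseLinear φ) :
    Tens A n →+ Tens A' m :=
  (PiTensorProduct.lift (R := ℤ) (E := Tens A' m)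
    { toFun := fun v => PiTensorProduct.tprod ℤ (φ v)
      map_update_add' := by
        intro inst v i x y
        obtain rfl : inst = instDecidableEqFin _ := Subsingleton.elim _ _
        obtain ⟨j, L, h⟩ := hφ v i
        simp only [h, map_add, MultilinearMap.map_update_add]
      map_update_smul' := by
        intro inst v i c x
        obtain rfl : inst = instDecidableEqFin _ := Subsingleton.elim _ _
        obtain ⟨j, L, h⟩ := hφ v i
        simp only [h, map_smul, MultilinearMap.map_update_smul] }).toAddMonoidHom

theorem ofTuple_tprod {A A' : Type u} [Ring A] [Ring A'] {n m : ℕ}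
    (φ : (Fin (n + 1) → A) → (Fin (m + 1) → A')) (hφ : EntrywiseLinear φ) (v : Fin (n + 1) → A) :
    ofTuple φ hφ (PiTensorProduct.tprod ℤ v) = PiTensorProduct.tprod ℤ (φ v) :=
  PiTensorProduct.lift.tprod _

/-- Additive maps out of `A^{⊗(n+1)}` agree if they agree on elementary tensors. -/
theorem tens_ext {A : Type u} [Ring A] {n : ℕ} {X : Type v} [AddCommGroup X]
    {f g : Tens A n →+ X}
    (h : ∀ v, f (PiTensorProduct.tprod ℤ v) = g (PiTensorProduct.tprod ℤ v)) (x : Tens A n) :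
    f x = g x := by
  induction x using PiTensorProduct.induction_on with
  | smul_tprod r v =>
    have key : r • (PiTensorProduct.tprod ℤ v : Tens A n)
        = (PiTensorProduct.tprod ℤ (Function.update v 0 (r • v 0)) : Tens A n) := by
      rw [MultilinearMap.map_update_smul, Function.update_eq_self]
    rw [key, h]
  | add x y hx hy => rw [map_add, map_add, hx, hy]

section operators

variable (A : Type u) [Ring A]

/-- The Hochschild face map `dᵢ : A^{⊗(n+2)} → A^{⊗(n+1)}`, for `0 ≤ i ≤ n + 1`. -/
noncomputable def face (n i : ℕ) : Tens A (n + 1) →+ Tens A n :=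
  ofTuple (faceTuple n i) (faceTuple_linear n i)

/-- The cyclic permutation `a₀ ⊗ ⋯ ⊗ aₙ ↦ aₙ ⊗ a₀ ⊗ ⋯ ⊗ aₙ₋₁`. -/
noncomputable def rot (n : ℕ) : AddMonoid.End (Tens A n) :=
  ofTuple (rotTuple n) (rotTuple_linear n)

/-- The cyclic operator with its sign, `(-1)ⁿ` times the cyclic permutation. -/
noncomputable def cyc (n : ℕ) : AddMonoid.End (Tens A n) := (-1 : ℤ) ^ n • rot A n

/-- The norm operator `1 + τ + ⋯ + τⁿ`, where `τ` is the signed cyclic operator. -/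
noncomputable def normOp (n : ℕ) : AddMonoid.End (Tens A n) :=
  ∑ k ∈ Finset.range (n + 1), cyc A n ^ k

/-- The extra degeneracy `a₀ ⊗ ⋯ ⊗ aₙ ↦ 1 ⊗ a₀ ⊗ ⋯ ⊗ aₙ`. -/
noncomputable def extra (n : ℕ) : Tens A n →+ Tens A (n + 1) :=
  ofTuple (extraTuple n) (extraTuple_linear n)

/-- The Hochschild boundary `b = ∑_{i=0}^{n+1} (-1)ⁱ dᵢ`. -/
noncomputable def bHoch (n : ℕ) : Tens A (n + 1) →+ Tens A n :=
  ∑ i ∈ Finset.range (n + 2), (-1 : ℤ) ^ i • face A n i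

/-- Connes' operator `B = (1 - τ) s N`, with `s` the extra degeneracy. -/
noncomputable def BConnes (n : ℕ) : Tens A n →+ Tens A (n + 1) :=
  AddMonoidHom.comp (1 - cyc A (n + 1) : AddMonoid.End (Tens A (n + 1)))
    ((extra A n).comp (normOp A n))

/-- The map of tensor powers induced by a ring homomorphism. -/
noncomputable def tensMap {A A' : Type u} [Ring A] [Ring A'] (f : A →+* A') (n : ℕ) :
    Tens A n →+ Tens A' n :=
  ofTuple (fun v j => f (v j)) (comp_linear f (n + 1))

end operators

section relations

/-- The sign cancellation behind `∂² = 0` for alternating sums of face maps. -/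
theorem alt_sum_comp {X Y Z : Type u} [AddCommGroup X] [AddCommGroup Y] [AddCommGroup Z]
    (n : ℕ) (D : ℕ → X →+ Y) (E : ℕ → Y →+ Z)
    (h : ∀ i j, i ≤ j → j < n + 1 → ∀ x, E i (D (j + 1) x) = E j (D i x)) (x : X) :
    (∑ i ∈ Finset.range (n + 1), (-1 : ℤ) ^ i • E i)
      ((∑ j ∈ Finset.range (n + 2), (-1 : ℤ) ^ j • D j) x) = 0 := by
  simp only [AddMonoidHom.finsetSum_apply, AddMonoidHom.smul_apply, map_sum, map_zsmul]
  rw [Finset.sum_congr rfl fun i _ => Finset.smul_sum]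
  rw [← Finset.sum_product']
  refine Finset.sum_involution
    (fun p _ => if p.1 ≤ p.2 then (p.2 + 1, p.1) else (p.2, p.1 - 1)) ?_ ?_ ?_ ?_
  · rintro ⟨j, i⟩ hp
    simp only [Finset.mem_product, Finset.mem_range] at hp
    by_cases hji : j ≤ i
    · simp only [hji, if_true]
      rw [h j i hji hp.2, pow_succ]
      simp only [smul_smul]
      rw [← add_smul]
      convert zero_smul ℤ _
      ring
    · obtain ⟨j, rfl⟩ : ∃ k, j = k + 1 := ⟨j - 1, by omega⟩
      simp only [hji, if_false, Nat.add_sub_cancel]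
      rw [h i j (by omega) (by omega), pow_succ]
      simp only [smul_smul]
      rw [← add_smul]
      convert zero_smul ℤ _
      ring
  · rintro ⟨j, i⟩ hp - heq
    by_cases hji : j ≤ i
    · simp only [hji, if_true, Prod.mk.injEq] at heq
      omega
    · simp only [hji, if_false, Prod.mk.injEq] at heq
      omega
  · rintro ⟨j, i⟩ hp
    simp only [Finset.mem_product, Finset.mem_range] at hp ⊢
    split_ifs <;> dsimp only <;> omega
  · rintro ⟨j, i⟩ hp
    by_cases hji : j ≤ i
    · simp only [hji, if_true]
      have : ¬ i + 1 ≤ j := by omega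
      simp [this]
    · have : i ≤ j - 1 := by omega
      simp only [hji, if_false, this, if_true, Prod.mk.injEq, and_true]
      omega

theorem exists_nat_tuple {A : Type u} {n : ℕ} (v : Fin (n + 1) → A) :
    ∃ w : ℕ → A, v = fun a : Fin (n + 1) => w (a : ℕ) :=
  ⟨fun m => if h : m < n + 1 then v ⟨m, h⟩ else v 0, by
    funext a
    have h := a.isLt
    simp only [h, dite_true]⟩

theorem rotTuple_nat {A : Type u} (n : ℕ) (v : Fin (n + 1) → A) (k : Fin (n + 1)) :
    rotTuple n v k
      = if (k : ℕ) = 0 then v (Fin.last n) else v ⟨(k : ℕ) - 1, by omega⟩ := by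
  refine Fin.cases ?_ (fun k => ?_) k
  · simp [rotTuple]
  · simp [rotTuple, Fin.castSucc, Fin.castAdd, Fin.castLE]

theorem extraTuple_nat {A : Type u} [One A] (n : ℕ) (v : Fin (n + 1) → A) (k : Fin (n + 2)) :
    extraTuple n v k
      = if h : (k : ℕ) = 0 then 1 else v ⟨(k : ℕ) - 1, by omega⟩ := by
  refine Fin.cases ?_ (fun k => ?_) k
  · simp [extraTuple]
  · simp [extraTuple]

variable {A : Type u} [Ring A]

theorem faceTuple_face (n i j : ℕ) (hij : i ≤ j) (hj : j < n + 2) (v : Fin (n + 3) → A) :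
    faceTuple n i (faceTuple (n + 1) (j + 1) v) = faceTuple n j (faceTuple (n + 1) i v) := by
  obtain ⟨w, rfl⟩ := exists_nat_tuple v
  funext k
  have hk := k.isLt
  have e1 := mul_assoc (w (n + 1)) (w (n + 2)) (w 0)
  have e2 := mul_assoc (w k) (w (k + 1)) (w (k + 2))
  simp only [faceTuple, Fin.ext_iff]
  simp only [Fin.val_zero, Fin.val_last, Fin.val_castSucc, Fin.val_succ]
  grind

theorem faceTuple_rot (n i : ℕ) (hi : i ≤ n) (v : Fin (n + 2) → A) :
    faceTuple n (i + 1) (rotTuple (n + 1) v) = rotTuple n (faceTuple n i v) := by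
  obtain ⟨w, rfl⟩ := exists_nat_tuple v
  funext k
  have hk := k.isLt
  simp only [faceTuple, rotTuple_nat, Fin.ext_iff]
  simp only [Fin.val_zero, Fin.val_last, Fin.val_castSucc, Fin.val_succ]
  grind

theorem faceTuple_zero_rot (n : ℕ) (v : Fin (n + 2) → A) :
    faceTuple n 0 (rotTuple (n + 1) v) = faceTuple n (n + 1) v := by
  obtain ⟨w, rfl⟩ := exists_nat_tuple v
  funext k
  have hk := k.isLt
  simp only [faceTuple, rotTuple_nat, Fin.ext_iff]
  simp only [Fin.val_zero, Fin.val_last, Fin.val_castSucc, Fin.val_succ]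
  grind

theorem faceTuple_zero_extra (n : ℕ) (v : Fin (n + 1) → A) :
    faceTuple n 0 (extraTuple n v) = v := by
  obtain ⟨w, rfl⟩ := exists_nat_tuple v
  funext k
  have hk := k.isLt
  simp only [faceTuple, extraTuple_nat, Fin.ext_iff]
  simp only [Fin.val_zero, Fin.val_last, Fin.val_castSucc, Fin.val_succ]
  grind

theorem faceTuple_succ_extra (n i : ℕ) (hi : i ≤ n) (v : Fin (n + 2) → A) :
    faceTuple (n + 1) (i + 1) (extraTuple (n + 1) v) = extraTuple n (faceTuple n i v) := by
  obtain ⟨w, rfl⟩ := exists_nat_tuple v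
  funext k
  have hk := k.isLt
  simp only [faceTuple, extraTuple_nat, Fin.ext_iff]
  simp only [Fin.val_zero, Fin.val_last, Fin.val_castSucc, Fin.val_succ]
  grind

theorem rotTuple_iterate {A : Type u} (n k : ℕ) (v : Fin (n + 1) → A) (j : Fin (n + 1)) :
    (rotTuple n)^[k] v j = v (j - k • (1 : Fin (n + 1))) := by
  induction k generalizing j with
  | zero => simp
  | succ k ih =>
    rw [Function.iterate_succ_apply', rotTuple_apply, ih]
    congr 1
    rw [succ_nsmul]
    abel

end relations

section identities

variable (A : Type u) [Ring A]

theorem face_face (n i j : ℕ) (hij : i ≤ j) (hj : j < n + 2) (x : Tens A (n + 2)) :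
    face A n i (face A (n + 1) (j + 1) x) = face A n j (face A (n + 1) i x) := by
  refine tens_ext (f := (face A n i).comp (face A (n + 1) (j + 1)))
    (g := (face A n j).comp (face A (n + 1) i)) (fun v => ?_) x
  simp only [AddMonoidHom.comp_apply, face, ofTuple_tprod, faceTuple_face n i j hij hj]

theorem bHoch_bHoch (n : ℕ) (x : Tens A (n + 2)) : bHoch A n (bHoch A (n + 1) x) = 0 :=
  alt_sum_comp (n + 1) (face A (n + 1)) (face A n)
    (fun i j hij hj x => face_face A n i j hij hj x) x

theorem face_rot (n i : ℕ) (hi : i ≤ n) (x : Tens A (n + 1)) :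
    face A n (i + 1) (rot A (n + 1) x) = rot A n (face A n i x) := by
  refine tens_ext (f := (face A n (i + 1)).comp (rot A (n + 1)))
    (g := AddMonoidHom.comp (rot A n) (face A n i)) (fun v => ?_) x
  simp only [AddMonoidHom.comp_apply, face, rot, ofTuple_tprod, faceTuple_rot n i hi]

theorem face_zero_rot (n : ℕ) (x : Tens A (n + 1)) :
    face A n 0 (rot A (n + 1) x) = face A n (n + 1) x := by
  refine tens_ext (f := (face A n 0).comp (rot A (n + 1)))
    (g := face A n (n + 1)) (fun v => ?_) x
  simp only [AddMonoidHom.comp_apply, face, rot, ofTuple_tprod, faceTuple_zero_rot n]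

theorem face_zero_extra (n : ℕ) (x : Tens A n) : face A n 0 (extra A n x) = x := by
  refine tens_ext (f := (face A n 0).comp (extra A n))
    (g := AddMonoidHom.id _) (fun v => ?_) x
  simp only [AddMonoidHom.comp_apply, face, extra, ofTuple_tprod, faceTuple_zero_extra n,
    AddMonoidHom.id_apply]

theorem face_succ_extra (n i : ℕ) (hi : i ≤ n) (x : Tens A (n + 1)) :
    face A (n + 1) (i + 1) (extra A (n + 1) x) = extra A n (face A n i x) := by
  refine tens_ext (f := (face A (n + 1) (i + 1)).comp (extra A (n + 1)))
    (g := (extra A n).comp (face A n i)) (fun v => ?_) x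
  simp only [AddMonoidHom.comp_apply, face, extra, ofTuple_tprod, faceTuple_succ_extra n i hi]

theorem rot_iterate_tprod (n k : ℕ) (v : Fin (n + 1) → A) :
    (rot A n)^[k] (PiTensorProduct.tprod ℤ v) = PiTensorProduct.tprod ℤ ((rotTuple n)^[k] v) := by
  induction k with
  | zero => rfl
  | succ k ih =>
    rw [Function.iterate_succ_apply', Function.iterate_succ_apply', ih]
    exact ofTuple_tprod _ _ _

theorem rot_pow (n : ℕ) : rot A n ^ (n + 1) = 1 := by
  refine AddMonoidHom.ext fun x => ?_
  refine tens_ext (fun v => ?_) x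
  change (rot A n ^ (n + 1)) (PiTensorProduct.tprod ℤ v) = PiTensorProduct.tprod ℤ v
  rw [AddMonoid.End.coe_pow]
  refine (rot_iterate_tprod A n (n + 1) v).trans ?_
  congr 1
  funext j
  have h : (n + 1) • (1 : Fin (n + 1)) = 0 := by
    have := card_nsmul_eq_zero' (x := (1 : Fin (n + 1)))
    rwa [Nat.card_eq_fintype_card, Fintype.card_fin] at this
  rw [rotTuple_iterate, h, sub_zero]

theorem cyc_apply (n : ℕ) (x : Tens A n) : cyc A n x = (-1 : ℤ) ^ n • rot A n x := rfl

theorem cyc_pow (n : ℕ) : cyc A n ^ (n + 1) = 1 := by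
  rcases Nat.even_or_odd n with h | h
  · rw [cyc, h.neg_one_pow, one_smul, rot_pow]
  · rw [cyc, h.neg_one_pow, neg_one_smul]
    exact (h.add_one.neg_pow (rot A n)).trans (rot_pow A n)

theorem one_sub_cyc_mul_norm (n : ℕ) : (1 - cyc A n) * normOp A n = 0 := by
  rw [normOp, mul_neg_geom_sum, cyc_pow, sub_self]

theorem norm_mul_one_sub_cyc (n : ℕ) : normOp A n * (1 - cyc A n) = 0 := by
  rw [normOp, geom_sum_mul_neg, cyc_pow, sub_self]

theorem BConnes_BConnes (n : ℕ) (x : Tens A n) : BConnes A (n + 1) (BConnes A n x) = 0 := by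
  have h := DFunLike.congr_fun (norm_mul_one_sub_cyc A (n + 1)) (extra A n (normOp A n x))
  have h' : normOp A (n + 1) (BConnes A n x) = 0 := h
  change (1 - cyc A (n + 2)) (extra A (n + 1) (normOp A (n + 1) (BConnes A n x))) = 0
  rw [h', map_zero, map_zero]

/-- The alternating sum `b' = ∑_{i=0}^{n} (-1)ⁱ dᵢ` of all faces but the last one. -/
noncomputable def bPrime (n : ℕ) : Tens A (n + 1) →+ Tens A n :=
  ∑ i ∈ Finset.range (n + 1), (-1 : ℤ) ^ i • face A n i

/-- The signed face `(-1)ⁱ dᵢ`. -/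
noncomputable def sface (n i : ℕ) : Tens A (n + 1) →+ Tens A n := (-1 : ℤ) ^ i • face A n i

theorem bPrime_apply (n : ℕ) (x : Tens A (n + 1)) :
    bPrime A n x = ∑ i ∈ Finset.range (n + 1), sface A n i x := by
  simp only [bPrime, sface, AddMonoidHom.finsetSum_apply]

theorem bHoch_apply (n : ℕ) (x : Tens A (n + 1)) :
    bHoch A n x = ∑ i ∈ Finset.range (n + 2), sface A n i x := by
  simp only [bHoch, sface, AddMonoidHom.finsetSum_apply]

theorem sface_cyc (n i : ℕ) (hi : i ≤ n) (x : Tens A (n + 1)) :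
    sface A n (i + 1) (cyc A (n + 1) x) = cyc A n (sface A n i x) := by
  simp only [sface, cyc_apply, AddMonoidHom.smul_apply, map_zsmul, face_rot A n i hi, smul_smul]
  congr 1
  rw [pow_succ, pow_succ]
  ring

theorem sface_zero_cyc (n : ℕ) (x : Tens A (n + 1)) :
    sface A n 0 (cyc A (n + 1) x) = sface A n (n + 1) x := by
  simp only [sface, cyc_apply, AddMonoidHom.smul_apply, map_zsmul, face_zero_rot, pow_zero,
    one_smul]

theorem bHoch_one_sub_cyc (n : ℕ) (x : Tens A (n + 1)) :
    bHoch A n ((1 - cyc A (n + 1)) x) = (1 - cyc A n) (bPrime A n x) := by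
  have e1 : (1 - cyc A (n + 1)) x = x - cyc A (n + 1) x := rfl
  have e2 : ∀ y : Tens A n, (1 - cyc A n) y = y - cyc A n y := fun _ => rfl
  rw [e1, e2, map_sub, bHoch_apply, bHoch_apply, bPrime_apply]
  have e3 : ∑ i ∈ Finset.range (n + 2), sface A n i (cyc A (n + 1) x)
      = cyc A n (∑ i ∈ Finset.range (n + 1), sface A n i x) + sface A n (n + 1) x := by
    rw [Finset.sum_range_succ', sface_zero_cyc, map_sum]
    congr 1
    refine Finset.sum_congr rfl fun i hi => ?_
    exact sface_cyc A n i (Nat.lt_succ_iff.mp (Finset.mem_range.mp hi)) x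
  rw [e3, Finset.sum_range_succ _ (n + 1)]
  abel

theorem sface_cyc_pow (n k : ℕ) (hk : k ≤ n + 1) (x : Tens A (n + 1)) :
    sface A n k ((cyc A (n + 1) ^ k) x) = (cyc A n ^ k) (sface A n 0 x) := by
  induction k with
  | zero => rfl
  | succ k ih =>
    rw [pow_succ', pow_succ']
    change sface A n (k + 1) (cyc A (n + 1) ((cyc A (n + 1) ^ k) x))
      = cyc A n ((cyc A n ^ k) (sface A n 0 x))
    rw [sface_cyc A n k (by omega), ih (by omega)]

theorem cyc_mul_norm (n : ℕ) : cyc A n * normOp A n = normOp A n := by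
  have h := one_sub_cyc_mul_norm A n
  rw [sub_mul, one_mul, sub_eq_zero] at h
  exact h.symm

theorem norm_mul_cyc (n : ℕ) : normOp A n * cyc A n = normOp A n := by
  have h := norm_mul_one_sub_cyc A n
  rw [mul_sub, mul_one, sub_eq_zero] at h
  exact h.symm

theorem cyc_pow_mul_norm (n k : ℕ) : cyc A n ^ k * normOp A n = normOp A n := by
  induction k with
  | zero => simp
  | succ k ih => rw [pow_succ, mul_assoc, cyc_mul_norm, ih]

theorem norm_mul_cyc_pow (n k : ℕ) : normOp A n * cyc A n ^ k = normOp A n := by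
  induction k with
  | zero => simp
  | succ k ih => rw [pow_succ', ← mul_assoc, norm_mul_cyc, ih]

theorem normOp_apply (n : ℕ) (x : Tens A n) :
    normOp A n x = ∑ k ∈ Finset.range (n + 1), (cyc A n ^ k) x := by
  rw [normOp]
  exact AddMonoidHom.finsetSum_apply _ _ _

theorem sum_range_reflect_cyclic {X : Type u} [AddCommGroup X] (n : ℕ) (g : ℕ → X)
    (hg : g (n + 1) = g 0) :
    ∑ k ∈ Finset.range (n + 1), g (n + 1 - k) = ∑ k ∈ Finset.range (n + 1), g k := by
  have h := Finset.sum_range_reflect (fun k => g (k + 1)) (n + 1)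
  rw [Finset.sum_range_succ' g, ← hg, ← Finset.sum_range_succ (fun k => g (k + 1)), ← h]
  refine Finset.sum_congr rfl fun k hk => ?_
  have hk' := Finset.mem_range.mp hk
  rw [show n + 1 - 1 - k + 1 = n + 1 - k by omega]

theorem bPrime_norm (n : ℕ) (x : Tens A (n + 1)) :
    bPrime A n (normOp A (n + 1) x) = normOp A n (bHoch A n x) := by
  have h1 : bPrime A n (normOp A (n + 1) x)
      = normOp A n (sface A n 0 (normOp A (n + 1) x)) := by
    rw [bPrime_apply, normOp_apply A n]
    refine Finset.sum_congr rfl fun k hk => ?_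
    rw [← sface_cyc_pow A n k (by have := Finset.mem_range.mp hk; omega)]
    congr 1
    exact (DFunLike.congr_fun (cyc_pow_mul_norm A (n + 1) k) x).symm
  have h2 : normOp A n (bHoch A n x) = normOp A n (sface A n 0 (normOp A (n + 1) x)) := by
    rw [bHoch_apply, normOp_apply A (n + 1), map_sum, map_sum (sface A n 0), map_sum (normOp A n)]
    have key : ∀ k ∈ Finset.range (n + 2), normOp A n (sface A n k x)
        = normOp A n (sface A n 0 ((cyc A (n + 1) ^ (n + 2 - k)) x)) := by
      intro k hk
      have hk' := Finset.mem_range.mp hk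
      have e : x = (cyc A (n + 1) ^ k) ((cyc A (n + 1) ^ (n + 2 - k)) x) := by
        have : cyc A (n + 1) ^ k * cyc A (n + 1) ^ (n + 2 - k) = 1 := by
          rw [← pow_add, show k + (n + 2 - k) = n + 1 + 1 by omega, cyc_pow]
        exact (DFunLike.congr_fun this x).symm
      conv_lhs => rw [e]
      rw [sface_cyc_pow A n k (by omega)]
      exact DFunLike.congr_fun (norm_mul_cyc_pow A n k) _
    refine (Finset.sum_congr rfl key).trans ?_
    refine sum_range_reflect_cyclic (n + 1)
      (fun k => normOp A n (sface A n 0 ((cyc A (n + 1) ^ k) x))) ?_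
    simp only [cyc_pow, pow_zero]
  rw [h1, h2]

theorem bPrime_extra (n : ℕ) (x : Tens A (n + 1)) :
    bPrime A (n + 1) (extra A (n + 1) x) = x - extra A n (bPrime A n x) := by
  rw [bPrime_apply, bPrime_apply, Finset.sum_range_succ', map_sum]
  have h0 : sface A (n + 1) 0 (extra A (n + 1) x) = x := by
    simp only [sface, pow_zero, one_smul, face_zero_extra]
  have h1 : ∀ i ∈ Finset.range (n + 1), sface A (n + 1) (i + 1) (extra A (n + 1) x)
      = - extra A n (sface A n i x) := by
    intro i hi
    simp only [sface, AddMonoidHom.smul_apply, map_zsmul,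
      face_succ_extra A n i (Nat.lt_succ_iff.mp (Finset.mem_range.mp hi)), pow_succ]
    simp
  rw [h0, Finset.sum_congr rfl h1, Finset.sum_neg_distrib]
  abel

theorem bHoch_BConnes (n : ℕ) (x : Tens A (n + 1)) :
    bHoch A (n + 1) (BConnes A (n + 1) x) + BConnes A n (bHoch A n x) = 0 := by
  change bHoch A (n + 1) ((1 - cyc A (n + 2)) (extra A (n + 1) (normOp A (n + 1) x)))
    + (1 - cyc A (n + 1)) (extra A n (normOp A n (bHoch A n x))) = 0
  rw [bHoch_one_sub_cyc, bPrime_extra, bPrime_norm, map_sub]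
  have h : (1 - cyc A (n + 1)) (normOp A (n + 1) x) = 0 :=
    DFunLike.congr_fun (one_sub_cyc_mul_norm A (n + 1)) x
  rw [h]
  abel

theorem bHoch_BConnes_zero (x : Tens A 0) : bHoch A 0 (BConnes A 0 x) = 0 := by
  change bHoch A 0 ((1 - cyc A 1) (extra A 0 (normOp A 0 x))) = 0
  rw [bHoch_one_sub_cyc, bPrime_apply]
  have h : (1 - cyc A 0) (normOp A 0 x) = 0 :=
    DFunLike.congr_fun (one_sub_cyc_mul_norm A 0) x
  simpa [sface, face_zero_extra] using h

end identities

section naturality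

variable {A A' A'' : Type u} [Ring A] [Ring A'] [Ring A'']

theorem tensMap_comp (g : A' →+* A'') (f : A →+* A') (n : ℕ) (x : Tens A n) :
    tensMap g n (tensMap f n x) = tensMap (g.comp f) n x := by
  refine tens_ext (f := (tensMap g n).comp (tensMap f n)) (g := tensMap (g.comp f) n)
    (fun v => ?_) x
  simp only [AddMonoidHom.comp_apply, tensMap, ofTuple_tprod]
  rfl

variable (f : A →+* A')

theorem tensMap_face (n i : ℕ) (x : Tens A (n + 1)) :
    tensMap f n (face A n i x) = face A' n i (tensMap f (n + 1) x) := by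
  refine tens_ext (f := (tensMap f n).comp (face A n i))
    (g := (face A' n i).comp (tensMap f (n + 1))) (fun v => ?_) x
  simp only [AddMonoidHom.comp_apply, tensMap, face, ofTuple_tprod]
  congr 1
  funext j
  simp only [faceTuple]
  split_ifs <;> simp

theorem tensMap_rot (n : ℕ) (x : Tens A n) :
    tensMap f n (rot A n x) = rot A' n (tensMap f n x) := by
  refine tens_ext (f := (tensMap f n).comp (rot A n))
    (g := AddMonoidHom.comp (rot A' n) (tensMap f n)) (fun v => ?_) x
  simp only [AddMonoidHom.comp_apply, tensMap, rot, ofTuple_tprod]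
  congr 1
  funext j
  simp only [rotTuple_apply]

theorem tensMap_extra (n : ℕ) (x : Tens A n) :
    tensMap f (n + 1) (extra A n x) = extra A' n (tensMap f n x) := by
  refine tens_ext (f := (tensMap f (n + 1)).comp (extra A n))
    (g := (extra A' n).comp (tensMap f n)) (fun v => ?_) x
  simp only [AddMonoidHom.comp_apply, tensMap, extra, ofTuple_tprod]
  congr 1
  funext j
  refine Fin.cases ?_ (fun j => ?_) j <;> simp [extraTuple]

theorem tensMap_bHoch (n : ℕ) (x : Tens A (n + 1)) :
    tensMap f n (bHoch A n x) = bHoch A' n (tensMap f (n + 1) x) := by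
  simp only [bHoch, AddMonoidHom.finsetSum_apply, map_sum, AddMonoidHom.smul_apply, map_zsmul,
    tensMap_face]

theorem tensMap_cyc (n : ℕ) (x : Tens A n) :
    tensMap f n (cyc A n x) = cyc A' n (tensMap f n x) := by
  rw [cyc_apply, cyc_apply, map_zsmul, tensMap_rot]

theorem tensMap_cyc_pow (n k : ℕ) (x : Tens A n) :
    tensMap f n ((cyc A n ^ k) x) = (cyc A' n ^ k) (tensMap f n x) := by
  induction k with
  | zero => rfl
  | succ k ih =>
    rw [pow_succ', pow_succ']
    change tensMap f n (cyc A n ((cyc A n ^ k) x)) = cyc A' n ((cyc A' n ^ k) (tensMap f n x))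
    rw [tensMap_cyc, ih]

theorem tensMap_BConnes (n : ℕ) (x : Tens A n) :
    tensMap f (n + 1) (BConnes A n x) = BConnes A' n (tensMap f n x) := by
  change tensMap f (n + 1) (extra A n (normOp A n x) - cyc A (n + 1) (extra A n (normOp A n x)))
    = extra A' n (normOp A' n (tensMap f n x))
      - cyc A' (n + 1) (extra A' n (normOp A' n (tensMap f n x)))
  rw [map_sub, tensMap_cyc, tensMap_extra, normOp_apply, normOp_apply, map_sum,
    Finset.sum_congr rfl fun k _ => tensMap_cyc_pow f n k x]

end naturality

/-! ### The mixed complex of a simplicial ring -/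

section simplicialRing

open Opposite

/-- The ring of `p`-simplices of a simplicial ring. -/
abbrev simplexRing (R : SimplicialObject RingCat.{u}) (p : ℕ) : Type u :=
  R.obj (op (SimplexCategory.mk p))

variable (R : SimplicialObject RingCat.{u})

/-- The boundary `∂ = ∑ (-1)ⁱ (dᵢ)^{⊗(q+1)} : R_{p+1}^{⊗(q+1)} → R_p^{⊗(q+1)}` in the
simplicial direction. -/
noncomputable def bdry (p q : ℕ) : Tens (simplexRing R (p + 1)) q →+ Tens (simplexRing R p) q :=
  ∑ i : Fin (p + 2), (-1 : ℤ) ^ (i : ℕ) • tensMap (R.δ i).hom q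

theorem bdry_bdry (p q : ℕ) (x : Tens (simplexRing R (p + 2)) q) :
    bdry R p q (bdry R (p + 1) q x) = 0 := by
  let D (p i : ℕ) : Tens (simplexRing R (p + 1)) q →+ Tens (simplexRing R p) q :=
    if h : i < p + 2 then tensMap (R.δ ⟨i, h⟩).hom q else 0
  have hD : ∀ p, bdry R p q = ∑ i ∈ Finset.range (p + 2), (-1 : ℤ) ^ i • D p i := by
    intro p
    rw [Finset.sum_range, bdry]
    refine Finset.sum_congr rfl fun i _ => ?_
    simp only [D, i.isLt, dite_true]
  rw [hD, hD]
  refine alt_sum_comp (p + 1) (D (p + 1)) (D p) (fun i j hij hj x => ?_) x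
  have h1 : i < p + 2 := by omega
  have h2 : j + 1 < p + 1 + 2 := by omega
  have h3 : i < p + 1 + 2 := by omega
  have h4 : j < p + 2 := by omega
  simp only [D, h1, h2, h3, h4, dite_true, tensMap_comp]
  have key := R.δ_comp_δ (n := p) (i := ⟨i, h1⟩) (j := ⟨j, h4⟩) hij
  have key' := congrArg RingCat.Hom.hom key
  rw [RingCat.hom_comp, RingCat.hom_comp] at key'
  exact congrArg (fun g => tensMap g q x) key'

theorem bdry_bHoch (p q : ℕ) (x : Tens (simplexRing R (p + 1)) (q + 1)) :
    bdry R p q (bHoch _ q x) = bHoch _ q (bdry R p (q + 1) x) := by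
  simp only [bdry, AddMonoidHom.finsetSum_apply, map_sum, AddMonoidHom.smul_apply, map_zsmul,
    tensMap_bHoch]

theorem bdry_BConnes (p q : ℕ) (x : Tens (simplexRing R (p + 1)) q) :
    bdry R p (q + 1) (BConnes _ q x) = BConnes _ q (bdry R p q x) := by
  simp only [bdry, AddMonoidHom.finsetSum_apply, map_sum, AddMonoidHom.smul_apply, map_zsmul,
    tensMap_BConnes]

/-- The direct sum of all the groups `R_p^{⊗(q+1)}`. -/
abbrev Total : Type u := DirectSum (ℕ × ℕ) fun pq => Tens (simplexRing R pq.1) pq.2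

/-- The inclusion of the summand `R_p^{⊗(q+1)}`. -/
noncomputable abbrev incl (p q : ℕ) : Tens (simplexRing R p) q →+ Total R :=
  DirectSum.of (fun pq : ℕ × ℕ => Tens (simplexRing R pq.1) pq.2) (p, q)

/-- The elements of total degree `n`, i.e. those supported on the summands `R_p^{⊗(q+1)}` with
`p + q = n`. -/
def totalGr (n : ℤ) : AddSubgroup (Total R) where
  carrier := {x | ∀ pq : ℕ × ℕ, (pq.1 : ℤ) + pq.2 ≠ n → x pq = 0}
  zero_mem' := fun _ _ => rfl
  add_mem' := by
    intro x y hx hy pq h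
    rw [DirectSum.add_apply, hx pq h, hy pq h, add_zero]
  neg_mem' := by
    intro x hx pq h
    change -(x pq) = 0
    rw [hx pq h, neg_zero]

/-- The Hochschild boundary `b` on the summand `R_p^{⊗(q+1)}`. -/
noncomputable def dHoch (p : ℕ) : (q : ℕ) → Tens (simplexRing R p) q →+ Total R
  | 0 => 0
  | q + 1 => (incl R p q).comp (bHoch (simplexRing R p) q)

/-- The signed simplicial boundary `(-1)^q ∂` on the summand `R_p^{⊗(q+1)}`. -/
noncomputable def dSimp (q : ℕ) : (p : ℕ) → Tens (simplexRing R p) q →+ Total R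
  | 0 => 0
  | p + 1 => (incl R p q).comp ((-1 : ℤ) ^ q • bdry R p q)

/-- The total differential `b + (-1)^q ∂`. -/
noncomputable def totalD : Total R →+ Total R :=
  DirectSum.toAddMonoid fun pq : ℕ × ℕ => dHoch R pq.1 pq.2 + dSimp R pq.2 pq.1

/-- Connes' operator on the total complex. -/
noncomputable def totalB : Total R →+ Total R :=
  DirectSum.toAddMonoid fun pq : ℕ × ℕ =>
    (incl R pq.1 (pq.2 + 1)).comp (BConnes (simplexRing R pq.1) pq.2)

theorem dHoch_succ (p q : ℕ) (x : Tens (simplexRing R p) (q + 1)) :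
    dHoch R p (q + 1) x = incl R p q (bHoch (simplexRing R p) q x) := rfl

theorem dSimp_succ (p q : ℕ) (x : Tens (simplexRing R (p + 1)) q) :
    dSimp R q (p + 1) x = incl R p q ((-1 : ℤ) ^ q • bdry R p q x) := rfl

theorem dHoch_zero (p : ℕ) (x : Tens (simplexRing R p) 0) : dHoch R p 0 x = 0 := rfl

theorem dSimp_zero (q : ℕ) (x : Tens (simplexRing R 0) q) : dSimp R q 0 x = 0 := rfl

theorem dHoch_dHoch (p q : ℕ) (x : Tens (simplexRing R p) (q + 1)) :
    dHoch R p q (bHoch (simplexRing R p) q x) = 0 := by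
  cases q with
  | zero => rfl
  | succ q => rw [dHoch_succ, bHoch_bHoch, map_zero]

theorem dSimp_dSimp (p q : ℕ) (x : Tens (simplexRing R (p + 1)) q) :
    dSimp R q p ((-1 : ℤ) ^ q • bdry R p q x) = 0 := by
  cases p with
  | zero => rfl
  | succ p =>
    rw [dSimp_succ, map_zsmul (bdry R p q), bdry_bdry, smul_zero, smul_zero, map_zero]

theorem totalD_incl (p q : ℕ) (x : Tens (simplexRing R p) q) :
    totalD R (incl R p q x) = dHoch R p q x + dSimp R q p x :=
  DirectSum.toAddMonoid_of (fun pq : ℕ × ℕ => dHoch R pq.1 pq.2 + dSimp R pq.2 pq.1) (p, q) x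

theorem totalB_incl (p q : ℕ) (x : Tens (simplexRing R p) q) :
    totalB R (incl R p q x) = incl R p (q + 1) (BConnes (simplexRing R p) q x) :=
  DirectSum.toAddMonoid_of (fun pq : ℕ × ℕ =>
    (incl R pq.1 (pq.2 + 1)).comp (BConnes (simplexRing R pq.1) pq.2)) (p, q) x

theorem incl_mem (p q : ℕ) (n : ℤ) (h : (p : ℤ) + q = n) (x : Tens (simplexRing R p) q) :
    incl R p q x ∈ totalGr R n := by
  intro pq hpq
  refine DirectSum.of_eq_of_ne _ _ _ ?_
  rintro rfl
  exact hpq h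

theorem totalGr_map {n m : ℤ} (φ : Total R →+ Total R)
    (h : ∀ p q : ℕ, (p : ℤ) + q = n → ∀ x, φ (incl R p q x) ∈ totalGr R m)
    (x : Total R) (hx : x ∈ totalGr R n) : φ x ∈ totalGr R m := by
  classical
  rw [← DirectSum.sum_support_of x, map_sum]
  refine sum_mem fun pq hpq => ?_
  refine h pq.1 pq.2 ?_ (x pq)
  by_contra hne
  exact (DFinsupp.mem_support_iff.mp hpq) (hx pq hne)

theorem total_ext {X : Type u} [AddCommGroup X] (φ ψ : Total R →+ X)
    (h : ∀ p q x, φ (incl R p q x) = ψ (incl R p q x)) (x : Total R) : φ x = ψ x :=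
  DFunLike.congr_fun (DirectSum.addHom_ext (fun pq y => h pq.1 pq.2 y)) x

/-- The mixed complex of a simplicial ring `R`: the total complex of the double complex
`R_p^{⊗(q+1)}` (simplicial direction `p`, Hochschild direction `q`), with Connes' operator `B`.
Its homology is the Hochschild homology of `R`. -/
noncomputable def hochschild : Mixed.{u} where
  T := Total R
  gr := totalGr R
  d := totalD R
  B := totalB R
  d_mem := by
    intro n x hx
    refine totalGr_map R (totalD R) (fun p q hpq x => ?_) x hx
    rw [totalD_incl]
    refine add_mem ?_ ?_
    · cases q with
      | zero => exact zero_mem _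
      | succ q => exact incl_mem R p q _ (by push_cast at hpq; omega) _
    · cases p with
      | zero => exact zero_mem _
      | succ p => exact incl_mem R p q _ (by push_cast at hpq; omega) _
  d_d := by
    refine total_ext R ((totalD R).comp (totalD R)) 0 fun p q x => ?_
    change totalD R (totalD R (incl R p q x)) = 0
    rw [totalD_incl, map_add]
    rcases q with _ | q <;> rcases p with _ | p
    · rw [dHoch_zero, dSimp_zero, map_zero, add_zero]
    · rw [dHoch_zero, dSimp_succ, map_zero, zero_add, totalD_incl, dSimp_dSimp, dHoch_zero,
        add_zero]
    · rw [dHoch_succ, dSimp_zero, map_zero, add_zero, totalD_incl, dHoch_dHoch, dSimp_zero,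
        add_zero]
    · rw [dHoch_succ, dSimp_succ, totalD_incl, totalD_incl, dHoch_dHoch, dSimp_dSimp,
        zero_add, add_zero, dHoch_succ, dSimp_succ, ← map_add, map_zsmul, bdry_bHoch,
        ← add_smul, pow_succ, mul_neg_one, add_neg_cancel, zero_smul, map_zero]
  B_mem := by
    intro n x hx
    refine totalGr_map R (totalB R) (fun p q hpq x => ?_) x hx
    rw [totalB_incl]
    exact incl_mem R p (q + 1) _ (by push_cast; omega) _
  B_B := by
    refine total_ext R ((totalB R).comp (totalB R)) 0 fun p q x => ?_
    change totalB R (totalB R (incl R p q x)) = 0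
    rw [totalB_incl, totalB_incl, BConnes_BConnes, map_zero]
  d_B := by
    refine total_ext R ((totalD R).comp (totalB R) + (totalB R).comp (totalD R)) 0
      fun p q x => ?_
    change totalD R (totalB R (incl R p q x)) + totalB R (totalD R (incl R p q x)) = 0
    rw [totalB_incl, totalD_incl, totalD_incl, map_add]
    have h1 : dHoch R p (q + 1) (BConnes (simplexRing R p) q x) + totalB R (dHoch R p q x)
        = 0 := by
      cases q with
      | zero => rw [dHoch_succ, dHoch_zero, bHoch_BConnes_zero, map_zero, map_zero, add_zero]
      | succ q =>
        rw [dHoch_succ, dHoch_succ, totalB_incl, ← map_add, bHoch_BConnes, map_zero]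
    have h2 : dSimp R (q + 1) p (BConnes (simplexRing R p) q x) + totalB R (dSimp R q p x)
        = 0 := by
      cases p with
      | zero => rw [dSimp_zero, dSimp_zero, map_zero, add_zero]
      | succ p =>
        rw [dSimp_succ, dSimp_succ, totalB_incl, ← map_add, map_zsmul, bdry_BConnes,
          ← add_smul, pow_succ, mul_neg_one, neg_add_cancel, zero_smul, map_zero]
    rw [add_add_add_comm, h1, h2, add_zero]

variable {R} {R' : SimplicialObject RingCat.{u}} (f : R ⟶ R')

/-- The map of total groups induced by a map of simplicial rings. -/
noncomputable def totalMap : Total R →+ Total R' :=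
  DirectSum.map fun pq : ℕ × ℕ => tensMap (f.app (op (SimplexCategory.mk pq.1))).hom pq.2

theorem totalMap_incl (p q : ℕ) (x : Tens (simplexRing R p) q) :
    totalMap f (incl R p q x)
      = incl R' p q (tensMap (f.app (op (SimplexCategory.mk p))).hom q x) :=
  DirectSum.map_of (fun pq : ℕ × ℕ => tensMap (f.app (op (SimplexCategory.mk pq.1))).hom pq.2)
    (p, q) x

theorem tensMap_bdry (p q : ℕ) (x : Tens (simplexRing R (p + 1)) q) :
    tensMap (f.app (op (SimplexCategory.mk p))).hom q (bdry R p q x)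
      = bdry R' p q (tensMap (f.app (op (SimplexCategory.mk (p + 1)))).hom q x) := by
  simp only [bdry, AddMonoidHom.finsetSum_apply, map_sum, AddMonoidHom.smul_apply, map_zsmul,
    tensMap_comp]
  refine Finset.sum_congr rfl fun i _ => ?_
  have key : (f.app (op (SimplexCategory.mk p))).hom.comp (R.δ i).hom
      = (R'.δ i).hom.comp (f.app (op (SimplexCategory.mk (p + 1)))).hom :=
    congrArg RingCat.Hom.hom (f.naturality (SimplexCategory.δ i).op)
  exact congrArg (fun g => (-1 : ℤ) ^ (i : ℕ) • tensMap g q x) key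

/-- The map of mixed complexes induced by a map of simplicial rings. -/
noncomputable def hochschildMap : Mixed.Hom (hochschild R) (hochschild R') where
  φ := totalMap f
  φ_mem := by
    intro n (x : Total R) hx pq hpq
    have h : totalMap f x pq = tensMap (f.app (op (SimplexCategory.mk pq.1))).hom pq.2 (x pq) :=
      rfl
    exact h.trans ((congrArg _ (hx pq hpq)).trans (map_zero _))
  φ_d := by
    refine total_ext R ((totalMap f).comp (totalD R)) ((totalD R').comp (totalMap f))
      fun p q x => ?_
    change totalMap f (totalD R (incl R p q x)) = totalD R' (totalMap f (incl R p q x))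
    rw [totalMap_incl, totalD_incl, totalD_incl, map_add]
    congr 1
    · cases q with
      | zero => exact map_zero _
      | succ q =>
        rw [dHoch_succ, dHoch_succ, totalMap_incl, tensMap_bHoch]
    · cases p with
      | zero => exact map_zero _
      | succ p =>
        rw [dSimp_succ, dSimp_succ, totalMap_incl, map_zsmul, tensMap_bdry]
  φ_B := by
    refine total_ext R ((totalMap f).comp (totalB R)) ((totalB R').comp (totalMap f))
      fun p q x => ?_
    change totalMap f (totalB R (incl R p q x)) = totalB R' (totalMap f (incl R p q x))
    rw [totalMap_incl, totalB_incl, totalB_incl, totalMap_incl, tensMap_BConnes]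

end simplicialRing

/-! ### The relative theories of a map of simplicial rings -/

section relative

variable {R R' : SimplicialObject RingCat.{u}} (f : R ⟶ R')

/-- The mixed complex of a map `f` of simplicial rings: the homotopy fiber of the map of mixed
complexes induced by `f`. -/
noncomputable def relHochschild : Mixed.{u} := Mixed.fiber (hochschildMap f)

/-- Relative Hochschild homology `HH_n(f)`: the homology of the homotopy fiber of
`HH(R) → HH(R')`. -/
abbrev HH (n : ℤ) : Type u := (relHochschild f).toCx.H n

/-- The relative operator `B : HH_n(f) → HH_{n+1}(f)`. -/
noncomputable def relB (n : ℤ) : HH f n →+ HH f (n + 1) :=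
  (relHochschild f).homologyB n (n + 1) rfl

/-- Relative negative cyclic homology `HC⁻_n(f)`: the homology of the homotopy fiber of
`HC⁻(R) → HC⁻(R')`. -/
abbrev HCneg (n : ℤ) : Type u :=
  (Cx.fiber (Mixed.negCyclicMap (hochschildMap f))).H n

/-- The map `F : HC⁻_n(f) → HH_n(f)`. -/
noncomputable def relF (n : ℤ) : HCneg f n →+ HH f n :=
  (Mixed.fiberF (hochschildMap f)).homology n

/-- A map `f` of simplicial rings is a de Rham equivalence if the de Rham homology of `f`, that
is, the homology of `HH_*(f)` with respect to the operator `B`, vanishes in all degrees. -/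
def IsDeRhamEquiv : Prop := ∀ n : ℤ, Subsingleton ((relHochschild f).deRham n)

end relative

end Cyclic

/-!
The statement holds for every mixed complex `M` whose homology is exact with respect to `B`;
nothing about simplicial rings is used beyond the mixed structure on the homotopy fiber.

*The image of `F` is `ker B`.* If `x = ∑ xᵢ tⁱ` is a negative cyclic cycle, then
`B x₀ = -d x₁` is a boundary.  Conversely, if `B [x₀] = 0`, then `[x₀] = B [y] = [B y]` for some
cycle `y` by exactness, and `B y`, as a constant series, is annihilated by `d + tB`, so `[x₀]`
lifts.

*Injectivity of `F`* (`Mixed.mem_boundaries_negCyclic`). Let `x` be a cycle with `x₀ = d z`.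
After subtracting `(d + tB) z`, the cycle `x` has the form `t x'`, and the class of `x'₀` lies in
`ker B = im B`.  Thus `x'₀ = B y + d z'`, and `t x'₀ = (d + tB)(y + t z') - t² B z'`. Iterating
removes the coefficients of `x` one at a time; the corrections made at stage `i` are multiples of
`tⁱ`, so they add up to a power series `w` with `(d + tB) w = x`.  As the complex is formed with
power series, no bound on the degrees of `M` is needed.

The fiber of the map of negative cyclic complexes is the negative cyclic complex of the fiber, up
to the interchange of products with series; this transfers both statements to the relative
groups.
-/

namespace Cyclic

namespace Cx

theorem mk_eq_zero_iff {C : Cx.{u}} {n : ℤ} (z : C.cycles n) :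
    (QuotientAddGroup.mk z : C.H n) = 0 ↔ (z : C.T) ∈ C.boundaries n := by
  rw [QuotientAddGroup.eq_zero_iff, AddSubgroup.mem_addSubgroupOf]

end Cx

namespace Mixed

/-- Vanishing of de Rham homology, on the level of chains: if the class of a cycle is killed
by `B`, then it is in the image of `B`. -/
theorem exists_eq_B_add_d (M : Mixed.{u}) {n : ℤ} (h : Subsingleton (M.deRham n)) {x : M.T}
    (hx : x ∈ M.cycles n) (hBx : M.B x ∈ M.boundaries (n + 1)) :
    ∃ y ∈ M.cycles (n - 1), ∃ z ∈ M.gr (n + 1), x = M.B y + M.d z := by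
  have hker : (QuotientAddGroup.mk (⟨x, hx⟩ : M.cycles n) : M.toCx.H n)
      ∈ (M.homologyB n (n + 1) rfl).ker := (Cx.mk_eq_zero_iff _).2 hBx
  have hzero : (QuotientAddGroup.mk ⟨_, hker⟩ : M.deRham n) = 0 := Subsingleton.elim _ _
  rw [QuotientAddGroup.eq_zero_iff, AddSubgroup.mem_addSubgroupOf] at hzero
  obtain ⟨η, hη⟩ := hzero
  obtain ⟨⟨y, hy⟩, rfl⟩ := QuotientAddGroup.mk_surjective η
  have hmem := AddSubgroup.mem_addSubgroupOf.1 (QuotientAddGroup.eq.1 hη)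
  obtain ⟨z, hz, hdz⟩ := hmem
  refine ⟨y, hy, z, hz, ?_⟩
  have e : M.d z = -M.B y + x := hdz
  rw [e, add_neg_cancel_left]

section negCyclic

variable (M : Mixed.{u})

theorem negCyclic_d_zero (x : ℕ → M.T) : M.negCyclic.d x 0 = M.d (x 0) := by
  change M.d (x 0) + 0 = _
  rw [add_zero]

theorem negCyclic_d_succ (x : ℕ → M.T) (i : ℕ) :
    M.negCyclic.d x (i + 1) = M.d (x (i + 1)) + M.B (x i) := rfl

variable {M} {n : ℤ}

/-- A negative cyclic cycle whose constant coefficient is a boundary is itself a boundary, if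
de Rham homology vanishes: this is the injectivity of `HC⁻ₙ(M) → HHₙ(M)`. -/
theorem mem_boundaries_negCyclic (h : ∀ m, Subsingleton (M.deRham m)) {x : ℕ → M.T}
    (hx : x ∈ M.negCyclic.cycles n) (hx0 : x 0 ∈ M.boundaries n) :
    x ∈ M.negCyclic.boundaries n := by
  obtain ⟨hgr, hd⟩ := hx
  have hd' : ∀ i, M.d (x (i + 1)) + M.B (x i) = 0 := fun i =>
    congrFun (show M.negCyclic.d x = 0 from hd) (i + 1)
  -- A partial solution `u i` is the coefficient of `tⁱ` in the series sought, up to a cycle `y`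
  -- that is only determined by the equation for the coefficient of `tⁱ⁺¹`.
  let S : ℕ → Type u := fun i =>
    {w : M.T // w ∈ M.gr (n + 1 + 2 * (i : ℤ)) ∧ M.B (x i - M.d w) = 0}
  have step : ∀ (i : ℕ) (w : S i), ∃ p : M.T × S (i + 1),
      p.1 ∈ M.cycles (n + 1 + 2 * (i : ℤ)) ∧ x (i + 1) = M.B (w.1 + p.1) + M.d p.2.1 := by
    rintro i ⟨w, hw, hBw⟩
    have hxi : x (i + 1) ∈ M.gr (n + 2 * ((i + 1 : ℕ) : ℤ)) := hgr (i + 1) trivial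
    have hxi' : x (i + 2) ∈ M.gr (n + 2 * ((i + 2 : ℕ) : ℤ)) := hgr (i + 2) trivial
    have hcyc : x (i + 1) - M.B w ∈ M.cycles (n + 2 * ((i + 1 : ℕ) : ℤ)) := by
      have hBw' := M.B_mem _ _ hw
      rw [show n + 1 + 2 * (i : ℤ) + 1 = n + 2 * ((i + 1 : ℕ) : ℤ) by push_cast; ring] at hBw'
      refine ⟨AddSubgroup.sub_mem _ hxi hBw', ?_⟩
      change M.d (x (i + 1) - M.B w) = 0
      rw [map_sub, eq_neg_of_add_eq_zero_left (hd' i), eq_neg_of_add_eq_zero_left (M.d_B w),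
        ← neg_eq_zero, ← hBw, map_sub]
      abel
    have hB : M.B (x (i + 1) - M.B w) ∈ M.boundaries (n + 2 * ((i + 1 : ℕ) : ℤ) + 1) := by
      refine ⟨-x (i + 2), neg_mem ?_, ?_⟩
      · rwa [show n + 2 * ((i + 2 : ℕ) : ℤ) = n + 2 * ((i + 1 : ℕ) : ℤ) + 1 + 1 by
          push_cast; ring] at hxi'
      · rw [map_sub, M.B_B, sub_zero, map_neg, eq_neg_of_add_eq_zero_left (hd' (i + 1)), neg_neg]
    obtain ⟨y, hy, z, hz, hyz⟩ := M.exists_eq_B_add_d (h _) hcyc hB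
    rw [show n + 2 * ((i + 1 : ℕ) : ℤ) - 1 = n + 1 + 2 * (i : ℤ) by push_cast; ring] at hy
    rw [show n + 2 * ((i + 1 : ℕ) : ℤ) + 1 = n + 1 + 2 * ((i + 1 : ℕ) : ℤ) by ring] at hz
    have hsum : x (i + 1) = M.B (w + y) + M.d z := by
      rw [map_add, add_assoc, ← hyz, add_sub_cancel]
    refine ⟨(y, ⟨z, hz, ?_⟩), hy, hsum⟩
    rw [hsum, add_sub_cancel_right, M.B_B]
  choose next hnext using step
  obtain ⟨z, hz, hdz⟩ := hx0
  let u : ∀ i, S i := fun i => Nat.rec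
    ⟨z, by simpa using hz, by rw [hdz, sub_self, map_zero]⟩ (fun i w => (next i w).2) i
  refine ⟨fun i => (u i).1 + (next i (u i)).1,
    fun i _ => add_mem (u i).2.1 (hnext i (u i)).1.1, ?_⟩
  have hy : ∀ i, M.d (next i (u i)).1 = 0 := fun i => (hnext i (u i)).1.2
  funext i
  cases i with
  | zero => rw [negCyclic_d_zero, map_add, hy, add_zero]; exact hdz
  | succ i =>
    rw [negCyclic_d_succ, map_add, hy, add_zero, add_comm]
    exact (hnext i (u i)).2.symm

theorem B_mem_boundaries_of_negCyclic {x : ℕ → M.T} (hx : x ∈ M.negCyclic.cycles n) :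
    M.B (x 0) ∈ M.boundaries (n + 1) := by
  obtain ⟨hgr, hd⟩ := hx
  have hx1 : x 1 ∈ M.gr (n + 2 * ((1 : ℕ) : ℤ)) := hgr 1 trivial
  have hd1 : M.d (x 1) + M.B (x 0) = 0 := congrFun (show M.negCyclic.d x = 0 from hd) 1
  refine ⟨-x 1, neg_mem ?_, ?_⟩
  · rwa [show n + 2 * ((1 : ℕ) : ℤ) = n + 1 + 1 by push_cast; ring] at hx1
  · rw [map_neg, eq_neg_of_add_eq_zero_left hd1, neg_neg]

/-- If `y` is a cycle of `M`, then `B y` is a cycle of the negative cyclic complex. -/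
theorem single_B_mem_cycles_negCyclic {y : M.T} (hy : y ∈ M.cycles (n - 1)) :
    (Pi.single 0 (M.B y) : ℕ → M.T) ∈ M.negCyclic.cycles n := by
  obtain ⟨hgr, hd⟩ := hy
  have hd : M.d y = 0 := hd
  have hBy := M.B_mem _ _ hgr
  rw [sub_add_cancel] at hBy
  refine ⟨fun i _ => ?_, ?_⟩
  · cases i with
    | zero => simpa using hBy
    | succ i => simp [zero_mem]
  · change M.negCyclic.d _ = 0
    funext i
    rcases i with _ | _ | i
    · rw [negCyclic_d_zero, Pi.single_eq_same, eq_neg_of_add_eq_zero_left (M.d_B y), hd,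
        map_zero, neg_zero]
      rfl
    · rw [negCyclic_d_succ]
      simp [M.B_B]
      rfl
    · rw [negCyclic_d_succ]
      simp
      rfl

end negCyclic

section fiber

variable {M : Mixed.{u}} {M' : Mixed.{v}} (f : Hom M M') {n : ℤ}

/-- The identification of pairs of power series with power series of pairs, which identifies the
fiber of the map of negative cyclic complexes with the negative cyclic complex of the fiber. -/
def pairSeries : (ℕ → M.T) × (ℕ → M'.T) ≃ (ℕ → M.T × M'.T) where
  toFun x i := (x.1 i, x.2 i)
  invFun w := (fun i => (w i).1, fun i => (w i).2)
  left_inv _ := rfl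
  right_inv _ := rfl

theorem pairSeries_mem_gr {x : (ℕ → M.T) × (ℕ → M'.T)} :
    pairSeries x ∈ (fiber f).negCyclic.gr n ↔ x ∈ (Cx.fiber (negCyclicMap f)).gr n := by
  have e : ∀ i : ℕ, n + 2 * (i : ℤ) + 1 = n + 1 + 2 * i := fun i => by ring
  constructor
  · intro h
    refine ⟨fun i hi => (h i hi).1, fun i hi => ?_⟩
    have := (h i hi).2
    rwa [e i] at this
  · rintro ⟨h1, h2⟩ i hi
    refine ⟨h1 i hi, ?_⟩
    have : x.2 i ∈ M'.gr (n + 1 + 2 * (i : ℤ)) := h2 i hi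
    rwa [← e i] at this

theorem pairSeries_d (x : (ℕ → M.T) × (ℕ → M'.T)) :
    pairSeries ((Cx.fiber (negCyclicMap f)).d x) = (fiber f).negCyclic.d (pairSeries x) := by
  obtain ⟨x, y⟩ := x
  funext i
  cases i with
  | zero =>
    apply Prod.ext
    · rfl
    · change f.φ (x 0) - (M'.d (y 0) + 0) = f.φ (x 0) - M'.d (y 0) + 0
      abel
  | succ i =>
    apply Prod.ext
    · rfl
    · change f.φ (x (i + 1)) - (M'.d (y (i + 1)) + M'.B (y i))
        = f.φ (x (i + 1)) - M'.d (y (i + 1)) + -M'.B (y i)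
      abel

theorem pairSeries_mem_cycles {x : (ℕ → M.T) × (ℕ → M'.T)} :
    pairSeries x ∈ (fiber f).negCyclic.cycles n ↔ x ∈ (Cx.fiber (negCyclicMap f)).cycles n := by
  refine and_congr (pairSeries_mem_gr f) ?_
  change (fiber f).negCyclic.d (pairSeries x) = 0 ↔ (Cx.fiber (negCyclicMap f)).d x = 0
  rw [← pairSeries_d]
  exact pairSeries.injective.eq_iff' rfl

theorem mem_boundaries_of_pairSeries {x : (ℕ → M.T) × (ℕ → M'.T)}
    (h : pairSeries x ∈ (fiber f).negCyclic.boundaries n) :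
    x ∈ (Cx.fiber (negCyclicMap f)).boundaries n := by
  obtain ⟨w, hw, hdw⟩ := h
  obtain ⟨w, rfl⟩ := pairSeries.surjective w
  exact ⟨w, (pairSeries_mem_gr f).1 hw, pairSeries.injective ((pairSeries_d f w).trans hdw)⟩

theorem fiberF_homology_injective (h : ∀ m, Subsingleton ((fiber f).deRham m)) :
    Function.Injective ((fiberF f).homology n) := by
  refine (injective_iff_map_eq_zero _).2 fun ξ hξ => ?_
  obtain ⟨⟨x, hx⟩, rfl⟩ := QuotientAddGroup.mk_surjective ξ
  rw [Cx.mk_eq_zero_iff]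
  exact mem_boundaries_of_pairSeries f
    (mem_boundaries_negCyclic h ((pairSeries_mem_cycles f).2 hx) ((Cx.mk_eq_zero_iff _).1 hξ))

theorem fiberF_homology_exact (h : Subsingleton ((fiber f).deRham n)) :
    Function.Exact ((fiberF f).homology n) ((fiber f).homologyB n (n + 1) rfl) := by
  intro ξ
  constructor
  · intro hξ
    obtain ⟨⟨x, hx⟩, rfl⟩ := QuotientAddGroup.mk_surjective ξ
    obtain ⟨y, hy, z, hz, rfl⟩ :=
      (fiber f).exists_eq_B_add_d h hx ((Cx.mk_eq_zero_iff _).1 hξ)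
    have hcyc := single_B_mem_cycles_negCyclic hy
    obtain ⟨w, hw⟩ := pairSeries.surjective (Pi.single 0 ((fiber f).B y) : ℕ → M.T × M'.T)
    refine ⟨QuotientAddGroup.mk ⟨w, (pairSeries_mem_cycles f).1 (hw ▸ hcyc)⟩, ?_⟩
    refine QuotientAddGroup.eq.2 (AddSubgroup.mem_addSubgroupOf.2 ⟨z, hz, ?_⟩)
    have hw0 : pairSeries w 0 = (fiber f).B y := congrFun hw 0
    have e : (fiber f).d z = -(fiber f).B y + ((fiber f).B y + (fiber f).d z) :=
      (neg_add_cancel_left _ _).symm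
    exact e.trans (congrArg (fun b => -b + ((fiber f).B y + (fiber f).d z)) hw0.symm)
  · rintro ⟨η, rfl⟩
    obtain ⟨⟨x, hx⟩, rfl⟩ := QuotientAddGroup.mk_surjective η
    exact (Cx.mk_eq_zero_iff _).2
      (B_mem_boundaries_of_negCyclic ((pairSeries_mem_cycles f).2 hx))

end fiber

end Mixed

end Cyclic

theorem proposition1p8 {R R' : CategoryTheory.SimplicialObject RingCat.{u}} (f : R ⟶ R')
    (hf : Cyclic.IsDeRhamEquiv f) (n : ℤ) :
    Function.Injective (Cyclic.relF f n) ∧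
    Function.Exact (Cyclic.relF f n) (Cyclic.relB f n) ∧
    ∃ e : Cyclic.HCneg f n ≃+ (Cyclic.relB f n).ker,
      ∀ x, (e x : Cyclic.HH f n) = Cyclic.relF f n x := by
  have hinj : Function.Injective (Cyclic.relF f n) :=
    Cyclic.Mixed.fiberF_homology_injective (Cyclic.hochschildMap f) hf
  have hex : Function.Exact (Cyclic.relF f n) (Cyclic.relB f n) :=
    Cyclic.Mixed.fiberF_homology_exact (Cyclic.hochschildMap f) (hf n)
  refine ⟨hinj, hex, AddEquiv.ofBijective
    ((Cyclic.relF f n).codRestrict (Cyclic.relB f n).ker fun x => hex.apply_apply_eq_zero x)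
    ⟨fun x y hxy => hinj (congrArg Subtype.val hxy), fun ⟨ξ, hξ⟩ => ?_⟩, fun _ => rfl⟩
  obtain ⟨x, hx⟩ := (hex ξ).1 hξ
  exact ⟨x, Subtype.ext hx⟩
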